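/- A 1-way probabilistic reversible decide-and-halt automaton (PRA-DH) has a finite input alphabet $\Sigma$, a finite set of states $Q$ partitioned into accepting, rejecting and non-halting states, an initial state $q_0\in Q$, and a transition function $\delta:Q\times\Gamma\times Q\to[0,1]$, where $\Gamma=\Sigma\cup\{\#,\$\}$ with end-markers $\#,\$\notin\Sigma$, such that $\sum_{q'\in Q}\delta(q,\sigma,q')=1$ and $\sum_{q'\in Q}\delta(q',\sigma,q)=1$ for all $q\in Q$, $\sigma\in\Gamma$. On an input word $w\in\Sigma^*$ the automaton starts in $q_0$ and reads $\#w\$$ once, symbol by symbol from left to right; when it is in state $q$ and reads $\sigma$, it enters $q'$ with probability $\delta(q,\sigma,q')$. As soon as it enters an accepting (rejecting) state it halts and accepts (rejects) $w$; it continues only from non-halting states. Let $P_{w,A}$ be the probability that the automaton $A$ accepts $w$. $A$ recognizes a language $L\subseteq\Sigma^*$ with bounded error if $\sup\{P_{w,A} : w\notin L\}<\inf\{P_{w,A} : w\in L\}$. Theorem. Let $a\ne b$ be letters of a finite alphabet $\Sigma$. Then no PRA-DH with input alphabet $\Sigma$ recognizes with bounded error the language $(a,b)^*a=\{ua : u\in\{a,b\}^*\}$.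 -/

import Mathlib

open scoped Computability

/-- The working alphabet `α ∪ {#, $}`: the input letters and the two end-markers. -/
inductive TapeSymbol (α : Type*) where
  | leftEnd : TapeSymbol α
  | letter : α → TapeSymbol α
  | rightEnd : TapeSymbol α

/-- The tape content `# w $` for the input word `w`. -/
def tape {α : Type*} (w : List α) : List (TapeSymbol α) :=
  TapeSymbol.leftEnd :: (w.map TapeSymbol.letter ++ [TapeSymbol.rightEnd])

/-- A 1-way probabilistic reversible decide-and-halt automaton (PRA-DH) with input alphabet `α` and
finite set of states `Q`: for every tape symbol the transition probabilities form a doubly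
stochastic matrix, and `Q` is partitioned into accepting, rejecting and non-halting states. -/
structure PRADH (α Q : Type*) [Fintype Q] where
  /-- the initial state -/
  q₀ : Q
  /-- the accepting states -/
  acc : Set Q
  /-- the rejecting states -/
  rej : Set Q
  disjoint_acc_rej : Disjoint acc rej
  /-- `δ q s q'` is the probability to go from `q` to `q'` when reading `s` -/
  δ : Q → TapeSymbol α → Q → ℝ
  δ_mem : ∀ q s q', δ q s q' ∈ Set.Icc (0 : ℝ) 1
  sum_out : ∀ q s, ∑ q', δ q s q' = 1
  sum_in : ∀ q s, ∑ q', δ q' s q = 1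

namespace PRADH

variable {α Q : Type*} [Fintype Q]

/-- The non-halting states: those that are neither accepting nor rejecting. -/
def nonhalting (A : PRADH α Q) : Set Q := (A.acc ∪ A.rej)ᶜ

/-- One step of the linear evolution: the distribution over states after reading `s`. -/
noncomputable def step (A : PRADH α Q) (s : TapeSymbol α) (v : Q → ℝ) : Q → ℝ :=
  fun q' => ∑ q, v q * A.δ q s q'

/-- `A.acceptFrom t v` is the probability that the computation halts in an accepting state while
the tape symbols `t` are read, if it is still running with (sub)distribution `v` over the states.
After each step the mass on accepting states is accepted, the mass on rejecting states is rejected,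
and only the mass on non-halting states continues. -/
noncomputable def acceptFrom (A : PRADH α Q) : List (TapeSymbol α) → (Q → ℝ) → ℝ
  | [], _ => 0
  | s :: t, v =>
      (∑ q, A.acc.indicator (A.step s v) q) +
        A.acceptFrom t (A.nonhalting.indicator (A.step s v))

/-- The probability that `A`, started in its initial state, accepts the word `w`. -/
noncomputable def acceptProb (A : PRADH α Q) (w : List α) : ℝ :=
  A.acceptFrom (tape w) (Set.indicator {A.q₀} 1)

/-- `A` recognizes `L` with interval `(p₁, p₂)`: `p₁` is the supremum of the acceptance
probabilities of the words outside `L`, `p₂` is the infimum of those of the words in `L`,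
and `p₁ < p₂`. -/
def RecognizesWithInterval (A : PRADH α Q) (L : Language α) (p₁ p₂ : ℝ) : Prop :=
  p₁ < p₂ ∧ IsLUB {p | ∃ w, w ∉ L ∧ A.acceptProb w = p} p₁ ∧
    IsGLB {p | ∃ w, w ∈ L ∧ A.acceptProb w = p} p₂

/-- `A` recognizes `L` with bounded error. -/
def RecognizesWithBoundedError (A : PRADH α Q) (L : Language α) : Prop :=
  ∃ p₁ p₂ : ℝ, A.RecognizesWithInterval L p₁ p₂

end PRADH

/-- The language `(a,b)*a`. -/
def endsInA {α : Type*} (a b : α) : Language α := ({[a]} + {[b]} : Language α)∗ * {[a]}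

open Filter Topology

/-! ### Recurrence of linear contractions. -/

section Contraction

variable {Q : Type*} [Fintype Q]

/-! Reading a letter never increases the mass of the running subdistribution, nor, by double
stochasticity, its Euclidean norm. The closure of the subdistributions reachable by words over `a`,
`b` is compact, so mass plus squared norm attains a minimum there, at some `v`. From `v`, words over
`a`, `b` lose neither quantity: nothing halts, and each letter acts isometrically on the minimizers.
By recurrence (`exists_iterate_succ_mem_of_contraction`) some `aᵏ⁺¹` and some `bˡ⁺¹` bring `v` back
arbitrarily close to itself, so followed by `$` they are accepted from `v` with nearly equal
probabilities. This contradicts `gap_stateAfter`, which extends to the closure by continuity. -/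

theorem sum_sq_map_sub_of_contraction (T : (Q → ℝ) →ₗ[ℝ] (Q → ℝ))
    (hT : ∀ v, ∑ q, T v q ^ 2 ≤ ∑ q, v q ^ 2) {x y : Q → ℝ}
    (hx : ∑ q, T x q ^ 2 = ∑ q, x q ^ 2) (hy : ∑ q, T y q ^ 2 = ∑ q, y q ^ 2) :
    ∑ q, T (x - y) q ^ 2 = ∑ q, (x - y) q ^ 2 := by
  have parallelogram : ∀ u v : Q → ℝ, ∑ q, (u - v) q ^ 2 + ∑ q, (u + v) q ^ 2 =
      2 * ∑ q, u q ^ 2 + 2 * ∑ q, v q ^ 2 := by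
    intro u v
    rw [← Finset.sum_add_distrib, Finset.mul_sum, Finset.mul_sum, ← Finset.sum_add_distrib]
    refine Finset.sum_congr rfl fun q _ => ?_
    simp only [Pi.sub_apply, Pi.add_apply]
    ring
  have h1 := parallelogram x y
  have h2 := parallelogram (T x) (T y)
  rw [← map_sub, ← map_add] at h2
  have h3 := hT (x - y)
  have h4 := hT (x + y)
  -- Both parallelogram laws have the same right-hand side, so the two inequalities `h3` and `h4`
  -- must be equalities.
  linarith

/-- A linear contraction is recurrent on a compact invariant set on which it preserves the
Euclidean norm. -/
theorem exists_iterate_succ_mem_of_contraction (T : (Q → ℝ) →ₗ[ℝ] (Q → ℝ))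
    (hT : ∀ v, ∑ q, T v q ^ 2 ≤ ∑ q, v q ^ 2) {K S : Set (Q → ℝ)} (hK : IsCompact K)
    (hSK : S ⊆ K) (hS : ∀ v ∈ S, T v ∈ S)
    (hST : ∀ v ∈ S, ∑ q, T v q ^ 2 = ∑ q, v q ^ 2)
    {v : Q → ℝ} (hv : v ∈ S) {U : Set (Q → ℝ)} (hU : U ∈ 𝓝 v) : ∃ k, T^[k + 1] v ∈ U := by
  have hmem : ∀ n, T^[n] v ∈ S := fun n => by
    induction n with
    | zero => exact hv
    | succ n ih => rw [Function.iterate_succ_apply']; exact hS _ ih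
  -- Distances along the orbit are shift-invariant, so two close late iterates yield an iterate
  -- close to `v` itself.
  have hshift : ∀ m k, ∑ q, (T^[k + m] v - T^[m] v) q ^ 2 = ∑ q, (T^[k] v - v) q ^ 2 := by
    intro m k
    induction m with
    | zero => rfl
    | succ m ih =>
      rw [← add_assoc, Function.iterate_succ_apply', Function.iterate_succ_apply', ← map_sub,
        sum_sq_map_sub_of_contraction T hT (hST _ (hmem _)) (hST _ (hmem _)), ih]
  obtain ⟨y, -, φ, hφ, hlim⟩ := hK.tendsto_subseq fun n => hSK (hmem n)
  have hdiff : Tendsto (fun j => ∑ q, (T^[φ (j + 1)] v - T^[φ j] v) q ^ 2) atTop (𝓝 0) := by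
    have h := (hlim.comp (tendsto_add_atTop_nat 1)).sub hlim
    have hc : Continuous fun u : Q → ℝ => ∑ q, u q ^ 2 := by fun_prop
    have h' := (hc.tendsto (y - y)).comp h
    simpa [Function.comp_def] using h'
  have hret : Tendsto (fun j => T^[φ (j + 1) - φ j] v) atTop (𝓝 v) := by
    refine tendsto_pi_nhds.2 fun q => tendsto_sub_nhds_zero_iff.1 ?_
    have hsq : Tendsto (fun j => (T^[φ (j + 1) - φ j] v q - v q) ^ 2) atTop (𝓝 0) := by
      refine squeeze_zero (fun j => sq_nonneg _) (fun j => ?_) hdiff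
      have hlt : φ j ≤ φ (j + 1) := (hφ (Nat.lt_succ_self j)).le
      have h := hshift (φ j) (φ (j + 1) - φ j)
      rw [Nat.sub_add_cancel hlt] at h
      rw [h]
      exact Finset.single_le_sum (f := fun q => (T^[φ (j + 1) - φ j] v - v) q ^ 2)
        (fun i _ => sq_nonneg _) (Finset.mem_univ q)
    have h := hsq.sqrt
    simp only [Real.sqrt_sq_eq_abs, Real.sqrt_zero] at h
    exact (tendsto_zero_iff_abs_tendsto_zero _).2 h
  obtain ⟨j, hj⟩ := (hret.eventually_mem hU).exists
  refine ⟨φ (j + 1) - φ j - 1, ?_⟩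
  -- Strictness makes the return time positive: at least one letter has to be read for the last
  -- letter to decide membership.
  have hlt : φ j < φ (j + 1) := hφ (Nat.lt_succ_self j)
  rwa [Nat.sub_add_cancel (by omega)]

end Contraction

/-! ### Mass and norm estimates for the automaton. -/

namespace PRADH

variable {α Q : Type*} [Fintype Q]

/-- The subdistribution on the non-halting states after one more symbol is read. -/
noncomputable def survive (A : PRADH α Q) (s : TapeSymbol α) : (Q → ℝ) →ₗ[ℝ] (Q → ℝ) where
  toFun v := A.nonhalting.indicator (A.step s v)
  map_add' u v := by
    rw [← Set.indicator_add']
    congr 1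
    ext q
    simp [step, add_mul, Finset.sum_add_distrib]
  map_smul' c v := by
    ext q
    by_cases h : q ∈ A.nonhalting <;> simp [h, step, mul_assoc, Finset.mul_sum]

theorem survive_apply (A : PRADH α Q) (s : TapeSymbol α) (v : Q → ℝ) :
    A.survive s v = A.nonhalting.indicator (A.step s v) := rfl

theorem acceptFrom_cons (A : PRADH α Q) (s : TapeSymbol α) (t : List (TapeSymbol α)) (v : Q → ℝ) :
    A.acceptFrom (s :: t) v =
      (∑ q, A.acc.indicator (A.step s v) q) + A.acceptFrom t (A.survive s v) := rfl

theorem step_nonneg (A : PRADH α Q) (s : TapeSymbol α) {v : Q → ℝ} (hv : 0 ≤ v) :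
    0 ≤ A.step s v :=
  fun _ => Finset.sum_nonneg fun q _ => mul_nonneg (hv q) (A.δ_mem _ _ _).1

theorem step_le_one (A : PRADH α Q) (s : TapeSymbol α) {v : Q → ℝ} (hv : v ≤ 1) :
    A.step s v ≤ 1 := fun q' => by
  refine le_trans (Finset.sum_le_sum fun q _ => ?_) (A.sum_in q' s).le
  exact mul_le_of_le_one_left (A.δ_mem _ _ _).1 (hv q)

theorem survive_mem_Icc (A : PRADH α Q) (s : TapeSymbol α) {v : Q → ℝ}
    (hv : v ∈ Set.Icc (0 : Q → ℝ) 1) : A.survive s v ∈ Set.Icc (0 : Q → ℝ) 1 := by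
  refine ⟨Set.indicator_nonneg fun q _ => A.step_nonneg s hv.1 q, ?_⟩
  exact (Set.indicator_le_self' fun q _ => A.step_nonneg s hv.1 q).trans (A.step_le_one s hv.2)

theorem sum_step (A : PRADH α Q) (s : TapeSymbol α) (v : Q → ℝ) :
    ∑ q, A.step s v q = ∑ q, v q := by
  simp only [step]
  rw [Finset.sum_comm]
  simp [← Finset.mul_sum, A.sum_out]

theorem acc_nonneg (A : PRADH α Q) (s : TapeSymbol α) {v : Q → ℝ} (hv : 0 ≤ v) :
    0 ≤ ∑ q, A.acc.indicator (A.step s v) q :=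
  Finset.sum_nonneg fun q _ => Set.indicator_nonneg (fun q _ => A.step_nonneg s hv q) q

theorem acc_add_survive_le (A : PRADH α Q) (s : TapeSymbol α) {v : Q → ℝ} (hv : 0 ≤ v) :
    (∑ q, A.acc.indicator (A.step s v) q) + ∑ q, A.survive s v q ≤ ∑ q, v q := by
  rw [← A.sum_step s v, ← Finset.sum_add_distrib]
  refine Finset.sum_le_sum fun q _ => ?_
  have h := A.step_nonneg s hv q
  rw [survive_apply]
  by_cases ha : q ∈ A.acc
  · have : q ∉ A.nonhalting := fun hn => hn (Or.inl ha)
    simp [ha, this]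
  · rw [Set.indicator_of_notMem ha, zero_add]
    exact Set.indicator_le_self' (fun q _ => A.step_nonneg s hv q) q

theorem sum_survive_le (A : PRADH α Q) (s : TapeSymbol α) {v : Q → ℝ} (hv : 0 ≤ v) :
    ∑ q, A.survive s v q ≤ ∑ q, v q := by
  linarith [A.acc_nonneg s hv, A.acc_add_survive_le s hv]

/-- Cauchy–Schwarz on each column, whose entries sum to one; the row sums then give the total. -/
theorem sum_sq_step_le (A : PRADH α Q) (s : TapeSymbol α) (v : Q → ℝ) :
    ∑ q, A.step s v q ^ 2 ≤ ∑ q, v q ^ 2 := by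
  calc ∑ q', A.step s v q' ^ 2 ≤ ∑ q', ∑ q, v q ^ 2 * A.δ q s q' := by
        refine Finset.sum_le_sum fun q' _ => ?_
        have h := Finset.sum_sq_le_sum_mul_sum_of_sq_le_mul Finset.univ
          (r := fun q => v q * A.δ q s q') (f := fun q => v q ^ 2 * A.δ q s q')
          (g := fun q => A.δ q s q') (fun q _ => mul_nonneg (sq_nonneg _) (A.δ_mem _ _ _).1)
          (fun q _ => (A.δ_mem _ _ _).1) (fun q _ => le_of_eq (by ring))
        rwa [A.sum_in, mul_one] at h
    _ = ∑ q, v q ^ 2 := by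
        rw [Finset.sum_comm]
        simp [← Finset.mul_sum, A.sum_out]

theorem sum_sq_survive_le (A : PRADH α Q) (s : TapeSymbol α) (v : Q → ℝ) :
    ∑ q, A.survive s v q ^ 2 ≤ ∑ q, v q ^ 2 := by
  refine le_trans (Finset.sum_le_sum fun q _ => ?_) (A.sum_sq_step_le s v)
  by_cases h : q ∈ A.nonhalting <;> simp [survive_apply, h, sq_nonneg]

theorem continuous_survive (A : PRADH α Q) (s : TapeSymbol α) : Continuous (A.survive s) :=
  (A.survive s).continuous_of_finiteDimensional

theorem continuous_acceptFrom (A : PRADH α Q) (t : List (TapeSymbol α)) :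
    Continuous (A.acceptFrom t) := by
  induction t with
  | nil => exact continuous_const
  | cons s t ih =>
    refine Continuous.add (continuous_finsetSum _ fun q _ => ?_) (ih.comp (A.continuous_survive s))
    by_cases h : q ∈ A.acc
    · simp only [Set.indicator_of_mem h, step]
      fun_prop
    · simp only [Set.indicator_of_notMem h]
      exact continuous_const

theorem acceptFrom_append (A : PRADH α Q) (t u : List (TapeSymbol α)) (v : Q → ℝ) :
    A.acceptFrom (t ++ u) v =
      A.acceptFrom t v + A.acceptFrom u (t.foldl (fun x s => A.survive s x) v) := by
  induction t generalizing v with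
  | nil => simp [acceptFrom]
  | cons s t ih => rw [List.cons_append, acceptFrom_cons, acceptFrom_cons, ih, List.foldl_cons,
      add_assoc]

/-- The subdistribution on the non-halting states after the left end-marker and `w` are read. -/
noncomputable def stateAfter (A : PRADH α Q) (w : List α) : Q → ℝ :=
  (TapeSymbol.leftEnd :: w.map TapeSymbol.letter).foldl (fun x s => A.survive s x)
    (Set.indicator {A.q₀} 1)

theorem acceptProb_append (A : PRADH α Q) (w u : List α) :
    A.acceptProb (w ++ u) =
      A.acceptFrom (TapeSymbol.leftEnd :: w.map TapeSymbol.letter) (Set.indicator {A.q₀} 1) +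
        A.acceptFrom (u.map TapeSymbol.letter ++ [TapeSymbol.rightEnd]) (A.stateAfter w) := by
  rw [stateAfter, ← acceptFrom_append]
  simp [acceptProb, tape]

theorem stateAfter_append_singleton (A : PRADH α Q) (w : List α) (x : α) :
    A.stateAfter (w ++ [x]) = A.survive (.letter x) (A.stateAfter w) := by
  simp [stateAfter]

theorem stateAfter_mem_Icc (A : PRADH α Q) (w : List α) :
    A.stateAfter w ∈ Set.Icc (0 : Q → ℝ) 1 := by
  induction w using List.reverseRecOn with
  | nil =>
    refine A.survive_mem_Icc _ ⟨Set.indicator_nonneg fun _ _ => zero_le_one, ?_⟩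
    exact Set.indicator_le_self' fun _ _ => zero_le_one
  | append_singleton w x ih =>
    rw [stateAfter_append_singleton]
    exact A.survive_mem_Icc _ ih

/-- If no mass is lost, none is left to be accepted, so the repeated symbol only moves the state. -/
theorem acceptFrom_replicate_append (A : PRADH α Q) (s : TapeSymbol α) {S : Set (Q → ℝ)}
    (hS0 : ∀ v ∈ S, 0 ≤ v) (hS : ∀ v ∈ S, A.survive s v ∈ S)
    (hmass : ∀ v ∈ S, ∑ q, A.survive s v q = ∑ q, v q) (t : List (TapeSymbol α)) (k : ℕ)
    {v : Q → ℝ} (hv : v ∈ S) :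
    A.acceptFrom (List.replicate k s ++ t) v = A.acceptFrom t ((A.survive s)^[k] v) := by
  induction k generalizing v with
  | zero => rfl
  | succ k ih =>
    rw [List.replicate_succ, List.cons_append, acceptFrom_cons, ih (hS v hv),
      Function.iterate_succ_apply]
    have h1 := A.acc_nonneg s (hS0 v hv)
    have h2 := A.acc_add_survive_le s (hS0 v hv)
    rw [hmass v hv] at h2
    linarith

end PRADH

/-! ### The language and the contradiction. -/

theorem mem_kstar_of_forall {α : Type*} {a b : α} {w : List α} (hw : ∀ x ∈ w, x = a ∨ x = b) :
    w ∈ ({[a]} + {[b]} : Language α)∗ := by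
  refine Language.mem_kstar.2 ⟨w.map fun x => [x], ?_, ?_⟩
  · induction w with
    | nil => rfl
    | cons x w ih => simp [← ih fun y hy => hw y (List.mem_cons_of_mem _ hy)]
  · intro y hy
    obtain ⟨x, hx, rfl⟩ := List.mem_map.1 hy
    rcases hw x hx with rfl | rfl
    · exact Or.inl rfl
    · exact Or.inr rfl

theorem append_mem_endsInA {α : Type*} {a b : α} {w : List α} (hw : ∀ x ∈ w, x = a ∨ x = b) :
    w ++ [a] ∈ endsInA a b :=
  Language.mem_mul.2 ⟨w, mem_kstar_of_forall hw, [a], rfl, rfl⟩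

theorem append_notMem_endsInA {α : Type*} {a b : α} (hab : a ≠ b) (w : List α) :
    w ++ [b] ∉ endsInA a b := by
  intro h
  obtain ⟨u, -, v, hv, huv⟩ := Language.mem_mul.1 h
  obtain rfl : v = [a] := hv
  exact hab (List.singleton_inj.1 (List.append_inj' huv rfl).2)

/-- `(a,b)*a` is separated, with a fixed gap, by the acceptance probabilities of
`w aᵏ⁺¹` and `w bˡ⁺¹`. -/
theorem PRADH.gap_stateAfter {α Q : Type*} [Fintype Q] {A : PRADH α Q} {a b : α} (hab : a ≠ b)
    {p₁ p₂ : ℝ} (h : A.RecognizesWithInterval (endsInA a b) p₁ p₂) {w : List α}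
    (hw : ∀ x ∈ w, x = a ∨ x = b) (k l : ℕ) :
    A.acceptFrom (List.replicate (l + 1) (.letter b) ++ [.rightEnd]) (A.stateAfter w) + (p₂ - p₁) ≤
      A.acceptFrom (List.replicate (k + 1) (.letter a) ++ [.rightEnd]) (A.stateAfter w) := by
  have ha : p₂ ≤ A.acceptProb (w ++ List.replicate (k + 1) a) := by
    refine h.2.2.1 ⟨_, ?_, rfl⟩
    rw [List.replicate_succ', ← List.append_assoc]
    refine append_mem_endsInA fun x hx => ?_
    rcases List.mem_append.1 hx with hx | hx
    · exact hw x hx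
    · exact Or.inl (List.eq_of_mem_replicate hx)
  have hb : A.acceptProb (w ++ List.replicate (l + 1) b) ≤ p₁ := by
    refine h.2.1.1 ⟨_, ?_, rfl⟩
    rw [List.replicate_succ', ← List.append_assoc]
    exact append_notMem_endsInA hab _
  rw [PRADH.acceptProb_append, List.map_replicate] at ha hb
  linarith

theorem mainTheorem8 {α : Type*} [Finite α] (a b : α) (hab : a ≠ b)
    {Q : Type*} [Fintype Q] (A : PRADH α Q) :
    ¬ A.RecognizesWithBoundedError (endsInA a b) := by
  rintro ⟨p₁, p₂, h⟩
  set R : Set (Q → ℝ) := A.stateAfter '' {w | ∀ x ∈ w, x = a ∨ x = b}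
  have hRIcc : closure R ⊆ Set.Icc 0 1 := by
    refine closure_minimal ?_ isClosed_Icc
    rintro _ ⟨w, -, rfl⟩
    exact A.stateAfter_mem_Icc w
  have hK : IsCompact (closure R) := isCompact_Icc.of_isClosed_subset isClosed_closure hRIcc
  have hinv : ∀ x, (x = a ∨ x = b) → ∀ v ∈ closure R, A.survive (.letter x) v ∈ closure R := by
    intro x hx v hv
    refine map_mem_closure (A.continuous_survive _) hv ?_
    rintro _ ⟨w, hw, rfl⟩
    refine ⟨w ++ [x], fun y hy => ?_, A.stateAfter_append_singleton w x⟩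
    rcases List.mem_append.1 hy with hy | hy
    · exact hw y hy
    · rwa [List.mem_singleton.1 hy]
  have hgap : ∀ k l : ℕ, ∀ v ∈ closure R,
      A.acceptFrom (List.replicate (l + 1) (.letter b) ++ [.rightEnd]) v + (p₂ - p₁) ≤
        A.acceptFrom (List.replicate (k + 1) (.letter a) ++ [.rightEnd]) v := by
    intro k l v hv
    refine closure_minimal (t := {v |
      A.acceptFrom (List.replicate (l + 1) (.letter b) ++ [.rightEnd]) v + (p₂ - p₁) ≤
        A.acceptFrom (List.replicate (k + 1) (.letter a) ++ [.rightEnd]) v}) ?_ ?_ hv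
    · rintro _ ⟨w, hw, rfl⟩
      exact PRADH.gap_stateAfter hab h hw k l
    · exact isClosed_le ((A.continuous_acceptFrom _).add continuous_const)
        (A.continuous_acceptFrom _)
  -- Neither summand can grow when a letter is read, so at a minimum of their sum both are
  -- conserved. `S` below consists of all minimizers and is therefore invariant under both letters.
  obtain ⟨v, hvK, hmin⟩ := hK.exists_isMinOn
    (f := fun v : Q → ℝ => ∑ q, v q + ∑ q, v q ^ 2)
    (Set.Nonempty.closure ⟨_, [], by simp, rfl⟩) (by fun_prop)
  set S : Set (Q → ℝ) :=
    {u ∈ closure R | ∑ q, u q + ∑ q, u q ^ 2 = ∑ q, v q + ∑ q, v q ^ 2}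
  have hvS : v ∈ S := ⟨hvK, rfl⟩
  have hS0 : ∀ u ∈ S, 0 ≤ u := fun u hu => (hRIcc hu.1).1
  have key : ∀ x, (x = a ∨ x = b) → ∀ u ∈ S, A.survive (.letter x) u ∈ S ∧
      ∑ q, A.survive (.letter x) u q = ∑ q, u q ∧
      ∑ q, A.survive (.letter x) u q ^ 2 = ∑ q, u q ^ 2 := by
    intro x hx u hu
    have h0 := hinv x hx u hu.1
    have h1 : ∑ q, v q + ∑ q, v q ^ 2 ≤
      ∑ q, A.survive (.letter x) u q + ∑ q, A.survive (.letter x) u q ^ 2 := hmin h0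
    have h2 := A.sum_survive_le (.letter x) (hS0 u hu)
    have h3 := A.sum_sq_survive_le (.letter x) u
    have h4 := hu.2
    exact ⟨⟨h0, by linarith⟩, by linarith, by linarith⟩
  -- Two errors, one for each letter, must together stay below the gap.
  have hp : 0 < (p₂ - p₁) / 2 := half_pos (sub_pos.2 h.1)
  have hrec : ∀ x, (x = a ∨ x = b) → ∃ k,
      |A.acceptFrom (List.replicate (k + 1) (.letter x) ++ [.rightEnd]) v -
        A.acceptFrom [.rightEnd] v| < (p₂ - p₁) / 2 := by
    intro x hx
    obtain ⟨k, hk⟩ := exists_iterate_succ_mem_of_contraction (A.survive (.letter x))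
      (A.sum_sq_survive_le _) hK (fun u hu => hu.1) (fun u hu => (key x hx u hu).1)
      (fun u hu => (key x hx u hu).2.2) hvS
      ((A.continuous_acceptFrom [.rightEnd]).continuousAt.preimage_mem_nhds
        (Metric.ball_mem_nhds _ hp))
    refine ⟨k, ?_⟩
    rw [A.acceptFrom_replicate_append _ hS0 (fun u hu => (key x hx u hu).1)
      (fun u hu => (key x hx u hu).2.1) _ _ hvS]
    exact hk
  obtain ⟨k, hk⟩ := hrec a (Or.inl rfl)
  obtain ⟨l, hl⟩ := hrec b (Or.inr rfl)
  have := hgap k l v hvK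
  rw [abs_lt] at hk hl
  linarith
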